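/- For real $\alpha$ with $0<\alpha<1$ let $$F(\alpha)=1+\Bigl(\tfrac12\Bigr)^2\alpha+\Bigl(\tfrac{1\cdot3}{2\cdot4}\Bigr)^2\alpha^2+\cdots=\sum_{n\ge0}\Bigl(\prod_{i=0}^{n-1}\tfrac{2i+1}{2i+2}\Bigr)^2\alpha^n ,$$ and for $0<k<1$ let $K(k)=\int_0^{\pi/2}\frac{d\theta}{\sqrt{1-k^2\sin^2\theta}}$ and $k'=\sqrt{1-k^2}$. Then the following hold. (1) (Modular equation of degree 3.) If $0<k,l<1$ and $3\,\frac{K(l')}{K(l)}=\frac{K(k')}{K(k)}$, then $\sqrt{kl}+\sqrt{k'l'}=1$. (2) (Modular equation of degree 7.) If $0<k,l<1$ and $7\,\frac{K(l')}{K(l)}=\frac{K(k')}{K(k)}$, then $\sqrt[4]{kl}+\sqrt[4]{k'l'}=1$. (3) If $0<\alpha<1$ and $F(1-\alpha)=\sqrt3\,F(\alpha)$, then $\alpha=\frac{2-\sqrt3}{4}$. (4) If $0<\alpha<1$ and $F(1-\alpha)=\sqrt7\,F(\alpha)$, then $\alpha=\frac{8-3\sqrt7}{16}$. -/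

import Mathlib

noncomputable section

/-- The series
`F(α) = 1 + (1/2)² α + ((1·3)/(2·4))² α² + ((1·3·5)/(2·4·6))² α³ + ⋯`
of a real variable; it converges for `-1 ≤ α < 1` and it is only used for `0 < α < 1`. -/
def ramanujanF (α : ℝ) : ℝ :=
  ∑' n : ℕ, (∏ i ∈ Finset.range n, (2 * (i : ℝ) + 1) / (2 * (i : ℝ) + 2)) ^ 2 * α ^ n

/-- The complete elliptic integral of the first kind with modulus `k`, for `0 ≤ k < 1`. -/
def completeEllipticK (k : ℝ) : ℝ :=
  ∫ θ in (0 : ℝ)..(Real.pi / 2), 1 / Real.sqrt (1 - k ^ 2 * Real.sin θ ^ 2)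

/-- The complementary modulus `k' = √(1 - k²)`, for `0 ≤ k ≤ 1`. -/
def complModulus (k : ℝ) : ℝ := Real.sqrt (1 - k ^ 2)

/-- The multiplication law of degree `n` between the moduli `k` and `l`:
`n · K(l') / K(l) = K(k') / K(k)`. -/
def MultiplicationLaw (n k l : ℝ) : Prop :=
  n * (completeEllipticK (complModulus l) / completeEllipticK l) =
    completeEllipticK (complModulus k) / completeEllipticK k

end

/-!
The moduli are parametrised by theta constants. For `t > 0` and `q = exp (-π t)` let `θ₂`, `θ₃`, `θ₄`
be the theta constants at `q`, and `k(t) = θ₂² / θ₃²`. Doubling `t` replaces `(θ₃², θ₄²)` by its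
arithmetic and geometric means (`thetaThree_sq`, `thetaFour_sq`, `thetaThree_mul_thetaFour`), and
Gauss's transformation `ellipticI_gauss` says that the elliptic integral is invariant under this
step. In the limit, `K(k(t)) = (π / 2) θ₃²` (`completeEllipticK_thetaModulus`). The transformation
`t ↦ 1 / t` of the theta constants exchanges `k` and `k'`, hence `K(k') / K(k) = t` for `k = k(t)`.
As `K(k') / K(k)` is strictly decreasing in `k`, every modulus is of the form `k(t)` with
`t = K(k') / K(k)`, and the multiplication law of degree `n` says that `l = k(t)`, `k = k(n t)`.

The modular equations become identities between theta constants at `q` and `qⁿ`.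
In degree 3 it is `θ₃(q) θ₃(q³) = θ₂(q) θ₂(q³) + θ₄(q) θ₄(q³)` (`theta_degree_three`), which compares
the values of `m² + 3n²` on `ℤ[√-3]` with those on the other Eisenstein integers by multiplication
with sixth roots of unity. In degree 7 the identity `theta_degree_seven` relates square roots of the
same products. After squaring, the mixed term is the root of `θ₂(q) θ₂(q⁷) θ₄(q) θ₄(q⁷)`, and
`θ₂ θ₄` is twice the square of the series `thetaQuarter`. What is left is linear in lattice sums of
norms from `ℤ[(1 + √-7)/2]`, and follows from division by `(1 + √-7)/2`, an element of norm 2.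

For the singular moduli, `F(k²) = (2 / π) K(k)` by termwise integration of the binomial series, so
the hypothesis is the multiplication law for the pair `k`, `k'`, and the modular equation gives
`k k'`, hence `α (1 - α)`. The root is singled out by `α < 1 / 2`, as `K` is increasing.
-/

/-! ### Gauss's transformation of the elliptic integral -/

section EllipticIntegral

open Real intervalIntegral

/-- The complete elliptic integral `∫₀^{π/2} dθ / √(a² cos² θ + b² sin² θ)` in the homogeneous
form for which the arithmetic-geometric mean iteration is natural. -/
noncomputable def ellipticI (a b : ℝ) : ℝ :=
  ∫ θ in (0 : ℝ)..(π / 2), 1 / √(a ^ 2 * cos θ ^ 2 + b ^ 2 * sin θ ^ 2)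

theorem sq_mul_cos_sq_add_sq_mul_sin_sq_pos {a b : ℝ} (ha : 0 < a) (hb : 0 < b) (θ : ℝ) :
    0 < a ^ 2 * cos θ ^ 2 + b ^ 2 * sin θ ^ 2 := by
  have h := sin_sq_add_cos_sq θ
  rcases eq_or_ne (sin θ) 0 with h0 | h0
  · have : cos θ ^ 2 = 1 := by rw [h0] at h; linarith
    rw [this, h0]; positivity
  · positivity

theorem mul_cos_sq_add_mul_sin_sq_pos {a b : ℝ} (ha : 0 < a) (hb : 0 < b) (θ : ℝ) :
    0 < a * cos θ ^ 2 + b * sin θ ^ 2 := by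
  simpa [sq_sqrt ha.le, sq_sqrt hb.le] using
    sq_mul_cos_sq_add_sq_mul_sin_sq_pos (sqrt_pos.2 ha) (sqrt_pos.2 hb) θ

theorem continuous_ellipticI_integrand {a b : ℝ} (ha : 0 < a) (hb : 0 < b) :
    Continuous fun θ : ℝ => 1 / √(a ^ 2 * cos θ ^ 2 + b ^ 2 * sin θ ^ 2) := by
  refine continuous_const.div (by fun_prop) fun θ => ?_
  exact (sqrt_pos.2 (sq_mul_cos_sq_add_sq_mul_sin_sq_pos ha hb θ)).ne'

theorem ellipticI_mul_mul {c : ℝ} (hc : 0 < c) (a b : ℝ) :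
    ellipticI (c * a) (c * b) = ellipticI a b / c := by
  unfold ellipticI
  rw [← integral_div]
  refine integral_congr fun θ _ => ?_
  rw [show (c * a) ^ 2 * cos θ ^ 2 + (c * b) ^ 2 * sin θ ^ 2
      = c ^ 2 * (a ^ 2 * cos θ ^ 2 + b ^ 2 * sin θ ^ 2) by ring,
    sqrt_mul (by positivity), sqrt_sq hc.le, div_div, mul_comm]

theorem ellipticI_mem_Icc {a b : ℝ} (hb : 0 < b) (hab : b ≤ a) :
    ellipticI a b ∈ Set.Icc (π / 2 / a) (π / 2 / b) := by
  have ha : 0 < a := hb.trans_le hab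
  have hpi : (0 : ℝ) ≤ π / 2 := by positivity
  have hint := (continuous_ellipticI_integrand ha hb).intervalIntegrable
    (μ := MeasureTheory.volume) 0 (π / 2)
  have key : ∀ θ : ℝ, b ^ 2 ≤ a ^ 2 * cos θ ^ 2 + b ^ 2 * sin θ ^ 2 ∧
      a ^ 2 * cos θ ^ 2 + b ^ 2 * sin θ ^ 2 ≤ a ^ 2 := fun θ => by
    have hsq : b ^ 2 ≤ a ^ 2 := pow_le_pow_left₀ hb.le hab 2
    have h := sin_sq_add_cos_sq θ
    constructor <;> nlinarith [mul_nonneg (sub_nonneg.2 hsq) (sq_nonneg (cos θ)),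
      mul_nonneg (sub_nonneg.2 hsq) (sq_nonneg (sin θ))]
  constructor
  · have := integral_mono_on (f := fun _ => 1 / a) hpi (by simp) hint fun θ _ =>
      one_div_le_one_div_of_le (sqrt_pos.2 (sq_mul_cos_sq_add_sq_mul_sin_sq_pos ha hb θ))
        ((sqrt_le_left ha.le).2 (key θ).2)
    simpa [ellipticI, div_eq_mul_inv] using this
  · have := integral_mono_on (g := fun _ => 1 / b) hpi hint (by simp) fun θ _ =>
      one_div_le_one_div_of_le hb (le_sqrt_of_sq_le (key θ).1)
    simpa [ellipticI, div_eq_mul_inv] using this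

theorem integral_zero_pi_eq_two_mul_ellipticI {a b : ℝ} (ha : 0 < a) (hb : 0 < b) :
    ∫ θ in (0 : ℝ)..π, 1 / √(a ^ 2 * cos θ ^ 2 + b ^ 2 * sin θ ^ 2) = 2 * ellipticI a b := by
  have hc := continuous_ellipticI_integrand ha hb
  rw [← integral_add_adjacent_intervals (hc.intervalIntegrable 0 (π / 2))
    (hc.intervalIntegrable (π / 2) π), two_mul]
  congr 1
  have h := integral_comp_sub_left (a := π / 2) (b := π)
    (fun θ => 1 / √(a ^ 2 * cos θ ^ 2 + b ^ 2 * sin θ ^ 2)) π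
  simp only [cos_pi_sub, sin_pi_sub, neg_sq, sub_self] at h
  rw [h, show π - π / 2 = π / 2 by ring, ellipticI]

/-- The angle `φ = θ + arctan ((b / a) tan θ)` of Landen's substitution. It is written through the
difference `θ - arctan ((b / a) tan θ)`, whose tangent is a quotient with positive denominator, so
that `φ` is visibly smooth on the whole line, including at `θ = π / 2`. -/
noncomputable def landenAngle (a b θ : ℝ) : ℝ :=
  2 * θ - arctan ((a - b) * (sin θ * cos θ) / (a * cos θ ^ 2 + b * sin θ ^ 2))

/-- `1 + tan² (2θ - φ)` for the Landen angle `φ`. -/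
theorem landenAngle_one_add_sq {a b : ℝ} (ha : 0 < a) (hb : 0 < b) (θ : ℝ) :
    1 + ((a - b) * (sin θ * cos θ) / (a * cos θ ^ 2 + b * sin θ ^ 2)) ^ 2 =
      (a ^ 2 * cos θ ^ 2 + b ^ 2 * sin θ ^ 2) / (a * cos θ ^ 2 + b * sin θ ^ 2) ^ 2 := by
  have hE := (mul_cos_sq_add_mul_sin_sq_pos ha hb θ).ne'
  rw [div_pow, eq_div_iff (pow_ne_zero 2 hE), add_mul, div_mul_cancel₀ _ (pow_ne_zero 2 hE)]
  linear_combination (a ^ 2 * cos θ ^ 2 + b ^ 2 * sin θ ^ 2) * sin_sq_add_cos_sq θ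

theorem hasDerivAt_landenAngle {a b : ℝ} (ha : 0 < a) (hb : 0 < b) (θ : ℝ) :
    HasDerivAt (landenAngle a b)
      ((a + b) * (a * cos θ ^ 2 + b * sin θ ^ 2) / (a ^ 2 * cos θ ^ 2 + b ^ 2 * sin θ ^ 2)) θ := by
  have hE := (mul_cos_sq_add_mul_sin_sq_pos ha hb θ).ne'
  have hD := (sq_mul_cos_sq_add_sq_mul_sin_sq_pos ha hb θ).ne'
  have hs := hasDerivAt_sin θ
  have hc := hasDerivAt_cos θ
  have h := ((hasDerivAt_id θ).const_mul 2).sub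
    ((((hs.mul hc).const_mul (a - b)).div
      (((hc.pow 2).const_mul a).add ((hs.pow 2).const_mul b)) hE).arctan)
  refine h.congr_deriv ?_
  simp only [Pi.mul_apply, Pi.pow_apply, Pi.add_apply, Pi.div_apply]
  rw [landenAngle_one_add_sq ha hb θ]
  have h1 := sin_sq_add_cos_sq θ
  field_simp
  have h2 : cos θ ^ 2 = 1 - sin θ ^ 2 := by linarith
  simp only [Nat.cast_ofNat, Nat.add_one_sub_one, pow_one]
  ring_nf
  simp only [show cos θ ^ 4 = (cos θ ^ 2) ^ 2 by ring, h2]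
  ring

/-- The quadratic form with coefficients the arithmetic and geometric means of `a` and `b`, taken at
the Landen angle of `θ`. -/
theorem ellipticI_landen_sq {a b : ℝ} (ha : 0 < a) (hb : 0 < b) (θ : ℝ) :
    ((a + b) / 2) ^ 2 * cos (landenAngle a b θ) ^ 2 + √(a * b) ^ 2 * sin (landenAngle a b θ) ^ 2 =
      ((a + b) / 2) ^ 2 * (a * cos θ ^ 2 + b * sin θ ^ 2) ^ 2 /
        (a ^ 2 * cos θ ^ 2 + b ^ 2 * sin θ ^ 2) := by
  have hE := (mul_cos_sq_add_mul_sin_sq_pos ha hb θ).ne'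
  have hD := (sq_mul_cos_sq_add_sq_mul_sin_sq_pos ha hb θ).ne'
  have h1 := sin_sq_add_cos_sq θ
  set x := (a - b) * (sin θ * cos θ) / (a * cos θ ^ 2 + b * sin θ ^ 2) with hx
  have hx2 := landenAngle_one_add_sq ha hb θ
  rw [← hx] at hx2
  have hw : √(1 + x ^ 2) ^ 2 = 1 + x ^ 2 := sq_sqrt (by positivity)
  have hpos : 0 < √(1 + x ^ 2) := sqrt_pos.2 (by positivity)
  have hcs : cos (landenAngle a b θ) * √(1 + x ^ 2) = cos (2 * θ) + sin (2 * θ) * x := by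
    rw [landenAngle, cos_sub, ← hx, cos_arctan, sin_arctan]; field_simp
  have hsn : sin (landenAngle a b θ) * √(1 + x ^ 2) = sin (2 * θ) - cos (2 * θ) * x := by
    rw [landenAngle, sin_sub, ← hx, cos_arctan, sin_arctan]; field_simp
  have hxE : x * (a * cos θ ^ 2 + b * sin θ ^ 2) = (a - b) * (sin θ * cos θ) := by
    rw [hx]; field_simp
  have e1 : (cos (2 * θ) + sin (2 * θ) * x) * (a * cos θ ^ 2 + b * sin θ ^ 2) =
      a * cos θ ^ 2 - b * sin θ ^ 2 := by
    rw [cos_two_mul, sin_two_mul]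
    linear_combination 2 * sin θ * cos θ * hxE + 2 * a * cos θ ^ 2 * h1
  have e2 : (sin (2 * θ) - cos (2 * θ) * x) * (a * cos θ ^ 2 + b * sin θ ^ 2) =
      (a + b) * (sin θ * cos θ) := by
    rw [cos_two_mul, sin_two_mul]
    linear_combination (1 - 2 * cos θ ^ 2) * hxE + 2 * b * (sin θ * cos θ) * h1
  rw [eq_div_iff hD]
  rw [eq_div_iff (pow_ne_zero 2 hE)] at hx2
  rw [sq_sqrt (mul_pos ha hb).le, ← hx2, ← hw]
  linear_combination ((a + b) / 2) ^ 2 * ((cos (landenAngle a b θ) * √(1 + x ^ 2) *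
    (a * cos θ ^ 2 + b * sin θ ^ 2)) + (a * cos θ ^ 2 - b * sin θ ^ 2)) *
    ((a * cos θ ^ 2 + b * sin θ ^ 2) * hcs + e1) +
    a * b * ((sin (landenAngle a b θ) * √(1 + x ^ 2) *
    (a * cos θ ^ 2 + b * sin θ ^ 2)) + (a + b) * (sin θ * cos θ)) *
    ((a * cos θ ^ 2 + b * sin θ ^ 2) * hsn + e2)

/-- Gauss's invariance of the elliptic integral under the arithmetic-geometric mean step. The Landen
angle maps `[0, π/2]` onto `[0, π]`, which accounts for a factor `2` on both sides. -/
theorem ellipticI_gauss {a b : ℝ} (ha : 0 < a) (hb : 0 < b) :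
    ellipticI ((a + b) / 2) √(a * b) = ellipticI a b := by
  have ha1 : 0 < (a + b) / 2 := by positivity
  have hb1 : 0 < √(a * b) := sqrt_pos.2 (mul_pos ha hb)
  have hsub := integral_comp_mul_deriv (a := 0) (b := π / 2)
    (fun θ _ => hasDerivAt_landenAngle ha hb θ)
    (Continuous.continuousOn (by
      refine Continuous.div (by fun_prop) (by fun_prop) fun θ => ?_
      exact (sq_mul_cos_sq_add_sq_mul_sin_sq_pos ha hb θ).ne'))
    (continuous_ellipticI_integrand ha1 hb1)
  have h0 : landenAngle a b 0 = 0 := by simp [landenAngle]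
  have h1 : landenAngle a b (π / 2) = π := by simp [landenAngle]; ring
  rw [h0, h1, integral_zero_pi_eq_two_mul_ellipticI ha1 hb1] at hsub
  suffices h : 2 * ellipticI ((a + b) / 2) √(a * b) = 2 * ellipticI a b by linarith
  rw [← hsub, ellipticI, ← integral_const_mul]
  refine integral_congr fun θ _ => ?_
  have hE := mul_cos_sq_add_mul_sin_sq_pos ha hb θ
  have hD := sq_mul_cos_sq_add_sq_mul_sin_sq_pos ha hb θ
  simp only [Function.comp_apply]
  rw [ellipticI_landen_sq ha hb, sqrt_div (by positivity), ← mul_pow, sqrt_sq (by positivity)]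
  have hr := sqrt_pos.2 hD
  nth_rewrite 2 [← sq_sqrt hD.le]
  field_simp

/-! ### The complete elliptic integral as a function of the modulus -/

theorem completeEllipticK_eq {k : ℝ} (hk : k ^ 2 ≤ 1) :
    completeEllipticK k = ellipticI 1 (complModulus k) := by
  refine integral_congr fun θ _ => ?_
  rw [complModulus, sq_sqrt (by linarith)]
  congr 2
  linear_combination -sin_sq_add_cos_sq θ

theorem complModulus_pos {k : ℝ} (h0 : 0 < k) (h1 : k < 1) : 0 < complModulus k :=
  sqrt_pos.2 (by nlinarith)

theorem complModulus_lt_one {k : ℝ} (h0 : 0 < k) : complModulus k < 1 :=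
  (sqrt_lt' one_pos).2 (by nlinarith)

theorem complModulus_complModulus {k : ℝ} (h0 : 0 < k) (h1 : k < 1) :
    complModulus (complModulus k) = k := by
  rw [complModulus, complModulus, sq_sqrt (by nlinarith), sub_sub_cancel, sqrt_sq h0.le]

theorem completeEllipticK_integrand_pos {k : ℝ} (h0 : 0 < k) (h1 : k < 1) (θ : ℝ) :
    0 < 1 - k ^ 2 * sin θ ^ 2 := by
  nlinarith [sin_sq_le_one θ, sq_nonneg (sin θ)]

theorem completeEllipticK_pos {k : ℝ} (h0 : 0 < k) (h1 : k < 1) : 0 < completeEllipticK k := by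
  rw [completeEllipticK_eq (by nlinarith)]
  exact (div_pos (by positivity) one_pos).trans_le
    (ellipticI_mem_Icc (complModulus_pos h0 h1) (complModulus_lt_one h0).le).1

theorem completeEllipticK_strictMonoOn : StrictMonoOn completeEllipticK (Set.Ioo 0 1) := by
  intro k hk l hl hkl
  have hcont : ∀ k ∈ Set.Ioo (0 : ℝ) 1, Continuous fun θ : ℝ => 1 / √(1 - k ^ 2 * sin θ ^ 2) :=
    fun k hk => continuous_const.div (by fun_prop) fun θ =>
      (sqrt_pos.2 (completeEllipticK_integrand_pos hk.1 hk.2 θ)).ne'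
  have hsq : k ^ 2 < l ^ 2 := pow_lt_pow_left₀ hkl hk.1.le two_ne_zero
  refine integral_lt_integral_of_continuousOn_of_le_of_exists_lt (by positivity)
    (hcont k hk).continuousOn (hcont l hl).continuousOn (fun θ _ => ?_)
    ⟨π / 2, by constructor <;> linarith [pi_pos], ?_⟩
  · refine one_div_le_one_div_of_le (sqrt_pos.2 (completeEllipticK_integrand_pos hl.1 hl.2 θ))
      (sqrt_le_sqrt ?_)
    nlinarith [sq_nonneg (sin θ)]
  · refine one_div_lt_one_div_of_lt
      (sqrt_pos.2 (completeEllipticK_integrand_pos hl.1 hl.2 _))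
      (sqrt_lt_sqrt (completeEllipticK_integrand_pos hl.1 hl.2 _).le ?_)
    simpa using hsq

/-- A modulus is determined by the ratio `K(k') / K(k)`, as this ratio is strictly decreasing. -/
theorem eq_of_completeEllipticK_ratio_eq {k l : ℝ} (hk : k ∈ Set.Ioo (0 : ℝ) 1)
    (hl : l ∈ Set.Ioo (0 : ℝ) 1)
    (h : completeEllipticK (complModulus k) / completeEllipticK k =
      completeEllipticK (complModulus l) / completeEllipticK l) : k = l := by
  have key : ∀ k ∈ Set.Ioo (0 : ℝ) 1, ∀ l ∈ Set.Ioo (0 : ℝ) 1, k < l →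
      completeEllipticK (complModulus l) / completeEllipticK l <
        completeEllipticK (complModulus k) / completeEllipticK k := fun k hk l hl hkl => by
    refine div_lt_div₀ ?_ (completeEllipticK_strictMonoOn hk hl hkl).le
      (completeEllipticK_pos (complModulus_pos hk.1 hk.2) (complModulus_lt_one hk.1)).le
      (completeEllipticK_pos hk.1 hk.2)
    refine completeEllipticK_strictMonoOn ⟨complModulus_pos hl.1 hl.2, complModulus_lt_one hl.1⟩
      ⟨complModulus_pos hk.1 hk.2, complModulus_lt_one hk.1⟩ ?_
    exact sqrt_lt_sqrt (by nlinarith [hl.1, hl.2]) (by nlinarith [hk.1])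
  rcases lt_trichotomy k l with hlt | heq | hgt
  · exact absurd h (key k hk l hl hlt).ne'
  · exact heq
  · exact absurd h (key l hl k hk hgt).ne

/-! ### The power series of the complete elliptic integral -/

theorem ringChoose_half_eq_prod (n : ℕ) :
    Ring.choose ((1 / 2 : ℝ) + n - 1) n =
      ∏ i ∈ Finset.range n, (2 * (i : ℝ) + 1) / (2 * (i : ℝ) + 2) := by
  have h := Ring.descPochhammer_eq_factorial_smul_choose ((1 / 2 : ℝ) + n - 1) n
  rw [Polynomial.descPochhammer_smeval_eq_ascPochhammer, Polynomial.ascPochhammer_smeval_eq_eval,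
    show (1 / 2 : ℝ) + n - 1 - n + 1 = 1 / 2 by ring, nsmul_eq_mul] at h
  have hn : (n.factorial : ℝ) ≠ 0 := by positivity
  refine mul_left_cancel₀ hn (h.symm.trans ?_)
  clear h hn
  induction n with
  | zero => simp
  | succ n ih =>
    rw [ascPochhammer_succ_eval, ih, Finset.prod_range_succ, Nat.factorial_succ]
    push_cast
    field_simp
    ring

theorem hasSum_one_div_sqrt_one_sub {x : ℝ} (h0 : 0 ≤ x) (h1 : x < 1) :
    HasSum (fun n : ℕ => (∏ i ∈ Finset.range n, (2 * (i : ℝ) + 1) / (2 * (i : ℝ) + 2)) * x ^ n)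
      (1 / √(1 - x)) := by
  have h := (Real.one_div_one_sub_rpow_hasFPowerSeriesOnBall_zero (1 / 2)).hasSum (y := x)
    (by simpa [enorm_eq_nnnorm, abs_of_nonneg h0, ← NNReal.coe_lt_coe] using h1)
  simp only [FormalMultilinearSeries.ofScalars_apply_eq, ringChoose_half_eq_prod, zero_add,
    smul_eq_mul, ← sqrt_eq_rpow] at h
  exact h

theorem integral_zero_half_pi_sin_pow_even (n : ℕ) :
    ∫ θ in (0 : ℝ)..(π / 2), sin θ ^ (2 * n) =
      π / 2 * ∏ i ∈ Finset.range n, (2 * (i : ℝ) + 1) / (2 * (i : ℝ) + 2) := by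
  have hc : Continuous fun θ : ℝ => sin θ ^ (2 * n) := by fun_prop
  have h := integral_add_adjacent_intervals
    (hc.intervalIntegrable (μ := MeasureTheory.volume) 0 (π / 2))
    (hc.intervalIntegrable (π / 2) π)
  have h2 := integral_comp_sub_left (a := π / 2) (b := π) (fun θ => sin θ ^ (2 * n)) π
  simp only [sin_pi_sub, sub_self] at h2
  rw [show π - π / 2 = π / 2 by ring] at h2
  rw [integral_sin_pow_even, h2] at h
  linarith

theorem completeEllipticK_eq_ramanujanF {k : ℝ} (h0 : 0 < k) (h1 : k < 1) :
    completeEllipticK k = π / 2 * ramanujanF (k ^ 2) := by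
  have hk2 : k ^ 2 < 1 := by nlinarith
  set c : ℕ → ℝ := fun n => ∏ i ∈ Finset.range n, (2 * (i : ℝ) + 1) / (2 * (i : ℝ) + 2) with hc
  have hc0 : ∀ n, 0 ≤ c n := fun n => Finset.prod_nonneg fun i _ => by positivity
  have hsum : HasSum (fun n => ∫ θ in (0 : ℝ)..(π / 2), c n * (k ^ 2 * sin θ ^ 2) ^ n)
      (completeEllipticK k) := by
    refine hasSum_integral_of_dominated_convergence (fun n _ => c n * (k ^ 2) ^ n)
      (fun n => Continuous.aestronglyMeasurable (by fun_prop)) (fun n => ?_) ?_ (by simp) ?_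
    · refine .of_forall fun θ _ => ?_
      rw [norm_of_nonneg (mul_nonneg (hc0 n) (by positivity))]
      refine mul_le_mul_of_nonneg_left (pow_le_pow_left₀ (by positivity) ?_ n) (hc0 n)
      exact mul_le_of_le_one_right (by positivity) (sin_sq_le_one θ)
    · exact .of_forall fun _ _ => (hasSum_one_div_sqrt_one_sub (by positivity) hk2).summable
    · exact .of_forall fun θ _ => hasSum_one_div_sqrt_one_sub (by positivity)
        (by linarith [completeEllipticK_integrand_pos h0 h1 θ])
  rw [← hsum.tsum_eq, ramanujanF, ← tsum_mul_left]
  refine tsum_congr fun n => ?_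
  simp only [mul_pow _ _ n, ← pow_mul]
  rw [integral_const_mul, integral_const_mul, integral_zero_half_pi_sin_pow_even]
  ring

end EllipticIntegral

section ThetaConstants

open Real HurwitzZeta Function

/-! ### Splitting and reindexing sums over `ℤ` and `ℤ × ℤ` -/

theorem tsum_eq_add_of_injective_of_cover {α β γ : Type*} {f : γ → ℝ} (hf : Summable f)
    {e₀ : α → γ} {e₁ : β → γ} (h₀ : Injective e₀) (h₁ : Injective e₁)
    (hd : ∀ x y, e₀ x ≠ e₁ y) (hc : ∀ z, (∃ x, e₀ x = z) ∨ ∃ y, e₁ y = z) :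
    ∑' z, f z = ∑' x, f (e₀ x) + ∑' y, f (e₁ y) := by
  have hcompl : IsCompl (Set.range e₀) (Set.range e₁) := by
    refine ⟨Set.disjoint_left.2 ?_, codisjoint_iff_le_sup.2 fun z _ => hc z⟩
    rintro _ ⟨x, rfl⟩ ⟨y, hy⟩
    exact hd x y hy.symm
  have a₀ := (hf.comp_injective h₀).hasSum
  have a₁ := (hf.comp_injective h₁).hasSum
  exact ((h₀.hasSum_range_iff.2 a₀).add_isCompl hcompl (h₁.hasSum_range_iff.2 a₁)).tsum_eq

theorem tsum_eq_add_of_even_of_odd {f : ℤ → ℝ} (hf : Summable f) :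
    ∑' n, f n = ∑' n, f (2 * n) + ∑' n, f (2 * n + 1) := by
  refine tsum_eq_add_of_injective_of_cover hf (fun a b h => by simpa using h)
    (fun a b h => by simpa using h) (fun a b => by omega) fun z => ?_
  obtain ⟨k, rfl | rfl⟩ := z.even_or_odd' <;> simp

/-- Splitting a lattice sum by the parity of the difference of the coordinates. -/
theorem tsum_eq_add_of_parity {f : ℤ × ℤ → ℝ} (hf : Summable f) :
    ∑' p, f p = ∑' p : ℤ × ℤ, f (2 * p.1 + p.2, p.2) +
      ∑' p : ℤ × ℤ, f (2 * p.1 + 1 + p.2, p.2) := by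
  refine tsum_eq_add_of_injective_of_cover hf (e₀ := fun p : ℤ × ℤ => (2 * p.1 + p.2, p.2))
    (e₁ := fun p : ℤ × ℤ => (2 * p.1 + 1 + p.2, p.2)) ?_ ?_ ?_ ?_
  · rintro ⟨a, b⟩ ⟨c, d⟩ h
    simp only [Prod.mk.injEq] at h ⊢; omega
  · rintro ⟨a, b⟩ ⟨c, d⟩ h
    simp only [Prod.mk.injEq] at h ⊢; omega
  · rintro ⟨a, b⟩ ⟨c, d⟩ h
    simp only [Prod.mk.injEq] at h; omega
  · rintro ⟨a, b⟩
    obtain ⟨k, hk | hk⟩ := (a - b).even_or_odd'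
    · exact .inl ⟨(k, b), Prod.ext (by dsimp only; omega) rfl⟩
    · exact .inr ⟨(k, b), Prod.ext (by dsimp only; omega) rfl⟩

theorem tsum_comp_eq_of_inverse {f : ℤ × ℤ → ℝ} (e e' : ℤ × ℤ → ℤ × ℤ)
    (h : LeftInverse e' e) (h' : RightInverse e' e) : ∑' p, f (e p) = ∑' p, f p :=
  (⟨e, e', h, h'⟩ : ℤ × ℤ ≃ ℤ × ℤ).tsum_eq f

/-- The same splitting by parity, with each class parametrised by the half sum and the half
difference of the coordinates; this diagonalises the form `x² + y²` again. -/
theorem tsum_eq_add_of_rotation {f : ℤ × ℤ → ℝ} (hf : Summable f) :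
    ∑' p, f p = ∑' p : ℤ × ℤ, f (p.1 + p.2, p.1 - p.2) +
      ∑' p : ℤ × ℤ, f (p.1 + p.2 + 1, p.1 - p.2) := by
  rw [tsum_eq_add_of_parity hf,
    ← tsum_comp_eq_of_inverse (fun p => (p.2, p.1 - p.2)) (fun p => (p.1 + p.2, p.1))
      (fun p => by ext <;> simp) (fun p => by ext <;> simp),
    ← tsum_comp_eq_of_inverse (f := fun p : ℤ × ℤ => f (2 * p.1 + 1 + p.2, p.2))
      (fun p => (p.2, p.1 - p.2)) (fun p => (p.1 + p.2, p.1))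
      (fun p => by ext <;> simp) (fun p => by ext <;> simp)]
  exact congrArg₂ _ (tsum_congr fun p => congrArg f (Prod.ext (by dsimp only; ring) rfl))
    (tsum_congr fun p => congrArg f (Prod.ext (by dsimp only; ring) rfl))

theorem HasSum.mul_prod {f g : ℤ → ℝ} {a b : ℝ} (hf : HasSum f a) (hg : HasSum g b) :
    HasSum (fun p : ℤ × ℤ => f p.1 * g p.2) (a * b) :=
  hf.mul hg (summable_mul_of_summable_norm hf.summable.norm hg.summable.norm)

/-! ### Theta constants on the imaginary axis -/

/-- The theta constant `θ₂ = ∑ q^((n + 1/2)²)` at the nome `q = exp (-π t)`. -/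
noncomputable def thetaTwo (t : ℝ) : ℝ := evenKernel ((1 / 2 : ℝ) : UnitAddCircle) t

/-- The theta constant `θ₃ = ∑ q^(n²)` at the nome `q = exp (-π t)`. -/
noncomputable def thetaThree (t : ℝ) : ℝ := evenKernel ((0 : ℝ) : UnitAddCircle) t

/-- The theta constant `θ₄ = ∑ (-1)ⁿ q^(n²)` at the nome `q = exp (-π t)`. -/
noncomputable def thetaFour (t : ℝ) : ℝ := cosKernel ((1 / 2 : ℝ) : UnitAddCircle) t

/-- The signed theta constant `∑ (-1)ⁿ q^((4n + 1)²/8)` at the nome `q = exp (-π t)`; it is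
`q^(1/8) ψ(-q)` with `ψ(q) = ∑_{n ≥ 0} q^(n(n+1)/2)`. -/
noncomputable def thetaQuarter (t : ℝ) : ℝ :=
  ∑' n : ℤ, (-1) ^ n * exp (-π * (4 * n + 1) ^ 2 * t / 8)

variable {t : ℝ}

theorem hasSum_thetaTwo (ht : 0 < t) :
    HasSum (fun n : ℤ => exp (-π * (n + 1 / 2) ^ 2 * t)) (thetaTwo t) :=
  hasSum_int_evenKernel _ ht

theorem hasSum_thetaThree (ht : 0 < t) :
    HasSum (fun n : ℤ => exp (-π * n ^ 2 * t)) (thetaThree t) := by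
  simpa [thetaThree] using hasSum_int_evenKernel 0 ht

theorem hasSum_thetaFour (ht : 0 < t) :
    HasSum (fun n : ℤ => (-1) ^ n * exp (-π * n ^ 2 * t)) (thetaFour t) := by
  rw [← Complex.hasSum_ofReal]
  refine (hasSum_int_cosKernel (1 / 2) ht).congr_fun fun n => ?_
  have : Complex.exp (2 * π * Complex.I * (1 / 2 : ℝ) * n) = (-1) ^ n := by
    rw [← Complex.exp_pi_mul_I, ← Complex.exp_int_mul]
    congr 1
    push_cast
    ring
  rw [this]
  push_cast
  rfl

theorem evenKernel_eq_add (a : ℝ) (ht : 0 < t) :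
    evenKernel (a : UnitAddCircle) t = evenKernel ((a / 2 : ℝ) : UnitAddCircle) (4 * t) +
      evenKernel (((a + 1) / 2 : ℝ) : UnitAddCircle) (4 * t) := by
  have h := hasSum_int_evenKernel a ht
  have ht4 : 0 < 4 * t := by positivity
  rw [← h.tsum_eq, tsum_eq_add_of_even_of_odd h.summable,
    ← (hasSum_int_evenKernel (a / 2) ht4).tsum_eq,
    ← (hasSum_int_evenKernel ((a + 1) / 2) ht4).tsum_eq]
  congr! 4 <;> · push_cast; ring

theorem neg_one_zpow_two_mul (n : ℤ) : (-1 : ℝ) ^ (2 * n) = 1 :=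
  (even_two_mul n).neg_one_zpow

theorem neg_one_zpow_two_mul_add_one (n : ℤ) : (-1 : ℝ) ^ (2 * n + 1) = -1 :=
  (odd_two_mul_add_one n).neg_one_zpow

theorem neg_one_zpow_mul_exp_mul (m n : ℤ) (x y : ℝ) :
    (-1) ^ m * exp x * ((-1) ^ n * exp y) = (-1) ^ (m + n) * exp (x + y) := by
  rw [mul_mul_mul_comm, ← zpow_add₀ (by norm_num), exp_add]

theorem thetaFour_eq_sub (ht : 0 < t) : thetaFour t = thetaThree (4 * t) - thetaTwo (4 * t) := by
  have h := hasSum_thetaFour ht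
  have ht4 : 0 < 4 * t := by positivity
  rw [← h.tsum_eq, tsum_eq_add_of_even_of_odd h.summable, ← (hasSum_thetaThree ht4).tsum_eq,
    ← (hasSum_thetaTwo ht4).tsum_eq, sub_eq_add_neg, ← tsum_neg]
  simp only [neg_one_zpow_two_mul, neg_one_zpow_two_mul_add_one, one_mul, neg_one_mul]
  congr! 3
  · congr 1; push_cast; ring
  · congr 2; push_cast; ring

theorem hasSum_thetaQuarter (ht : 0 < t) :
    HasSum (fun n : ℤ => (-1) ^ n * exp (-π * (4 * n + 1) ^ 2 * t / 8)) (thetaQuarter t) := by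
  refine Summable.hasSum ?_
  refine (hasSum_int_evenKernel (1 / 4) (t := 2 * t) (by positivity)).summable.of_norm_bounded
    fun n => ?_
  rw [norm_mul, norm_zpow, norm_neg, norm_one, one_zpow, one_mul, norm_of_nonneg (exp_pos _).le]
  apply le_of_eq
  congr 1
  ring

theorem thetaQuarter_eq_sub (ht : 0 < t) :
    thetaQuarter t = evenKernel ((1 / 8 : ℝ) : UnitAddCircle) (8 * t) -
      evenKernel ((5 / 8 : ℝ) : UnitAddCircle) (8 * t) := by
  have h := hasSum_thetaQuarter ht
  have ht8 : 0 < 8 * t := by positivity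
  rw [← h.tsum_eq, tsum_eq_add_of_even_of_odd h.summable,
    ← (hasSum_int_evenKernel _ ht8).tsum_eq, ← (hasSum_int_evenKernel _ ht8).tsum_eq,
    sub_eq_add_neg, ← tsum_neg]
  simp only [neg_one_zpow_two_mul, neg_one_zpow_two_mul_add_one, one_mul, neg_one_mul]
  congr! 3
  · congr 1; push_cast; ring
  · congr 2; push_cast; ring

theorem thetaThree_functional_equation (t : ℝ) :
    thetaThree (1 / t) = √t * thetaThree t := by
  have h : thetaThree (1 / t) = 1 / (1 / t) ^ (1 / 2 : ℝ) * thetaThree (1 / (1 / t)) := by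
    simp only [thetaThree, QuotientAddGroup.mk_zero]
    rw [evenKernel_functional_equation, ← evenKernel_eq_cosKernel_of_zero]
  rw [h, ← sqrt_eq_rpow, one_div_one_div, sqrt_div zero_le_one, sqrt_one, one_div_one_div]

theorem thetaTwo_functional_equation (t : ℝ) :
    thetaTwo (1 / t) = √t * thetaFour t := by
  rw [thetaTwo, evenKernel_functional_equation, ← sqrt_eq_rpow, one_div_one_div,
    sqrt_div zero_le_one, sqrt_one, one_div_one_div, thetaFour]

theorem thetaTwo_pos (ht : 0 < t) : 0 < thetaTwo t := by
  rw [← (hasSum_thetaTwo ht).tsum_eq]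
  exact (hasSum_thetaTwo ht).summable.tsum_pos (fun _ => (exp_pos _).le) 0 (exp_pos _)

theorem thetaThree_pos (ht : 0 < t) : 0 < thetaThree t := by
  rw [← (hasSum_thetaThree ht).tsum_eq]
  exact (hasSum_thetaThree ht).summable.tsum_pos (fun _ => (exp_pos _).le) 0 (exp_pos _)

/-- The defining series of `θ₄` has terms of both signs; positivity comes from the transformation
`t ↦ 1 / t`, which turns `θ₄` into `θ₂`. -/
theorem thetaFour_pos (ht : 0 < t) : 0 < thetaFour t := by
  have h := thetaTwo_functional_equation t
  have h2 := thetaTwo_pos (t := 1 / t) (by positivity)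
  rw [h] at h2
  exact pos_of_mul_pos_right h2 (sqrt_nonneg t)

/-! ### Duplication formulas -/

theorem thetaThree_sq (ht : 0 < t) :
    thetaThree t ^ 2 = thetaThree (2 * t) ^ 2 + thetaTwo (2 * t) ^ 2 := by
  have ht2 : 0 < 2 * t := by positivity
  have h := (hasSum_thetaThree ht).mul_prod (hasSum_thetaThree ht)
  rw [pow_two, ← h.tsum_eq, tsum_eq_add_of_rotation h.summable, pow_two, pow_two,
    ← ((hasSum_thetaThree ht2).mul_prod (hasSum_thetaThree ht2)).tsum_eq,
    ← ((hasSum_thetaTwo ht2).mul_prod (hasSum_thetaTwo ht2)).tsum_eq]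
  simp only [← exp_add]
  congr! 4 <;> · push_cast; ring

theorem thetaFour_sq (ht : 0 < t) :
    thetaFour t ^ 2 = thetaThree (2 * t) ^ 2 - thetaTwo (2 * t) ^ 2 := by
  have ht2 : 0 < 2 * t := by positivity
  have h := (hasSum_thetaFour ht).mul_prod (hasSum_thetaFour ht)
  rw [pow_two, ← h.tsum_eq, tsum_eq_add_of_rotation h.summable, pow_two, pow_two,
    ← ((hasSum_thetaThree ht2).mul_prod (hasSum_thetaThree ht2)).tsum_eq,
    ← ((hasSum_thetaTwo ht2).mul_prod (hasSum_thetaTwo ht2)).tsum_eq, sub_eq_add_neg, ← tsum_neg]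
  simp only [neg_one_zpow_mul_exp_mul, ← exp_add]
  congr! 3 with p p
  · rw [show p.1 + p.2 + (p.1 - p.2) = 2 * p.1 by ring, neg_one_zpow_two_mul, one_mul]
    congr 1; push_cast; ring
  · rw [show p.1 + p.2 + 1 + (p.1 - p.2) = 2 * p.1 + 1 by ring, neg_one_zpow_two_mul_add_one,
      neg_one_mul]
    congr 2; push_cast; ring

theorem thetaTwo_sq (ht : 0 < t) :
    thetaTwo t ^ 2 = 2 * thetaTwo (2 * t) * thetaThree (2 * t) := by
  have ht2 : 0 < 2 * t := by positivity
  have h := (hasSum_thetaTwo ht).mul_prod (hasSum_thetaTwo ht)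
  have e : 2 * thetaTwo (2 * t) * thetaThree (2 * t) = thetaTwo (2 * t) * thetaThree (2 * t) +
    thetaThree (2 * t) * thetaTwo (2 * t) := by ring
  rw [e, pow_two, ← h.tsum_eq, tsum_eq_add_of_rotation h.summable,
    ← ((hasSum_thetaTwo ht2).mul_prod (hasSum_thetaThree ht2)).tsum_eq,
    ← ((hasSum_thetaThree ht2).mul_prod (hasSum_thetaTwo ht2)).tsum_eq,
    ← tsum_comp_eq_of_inverse (f := fun p : ℤ × ℤ => exp (-π * p.1 ^ 2 * (2 * t)) * _)
      (fun p => (p.1 + 1, p.2)) (fun p => (p.1 - 1, p.2))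
      (fun p => by ext <;> simp) (fun p => by ext <;> simp)]
  simp only [← exp_add]
  congr! 4 <;> · push_cast; ring

/-- Jacobi's quartic identity, a consequence of the three duplication formulas. -/
theorem thetaThree_pow_four (ht : 0 < t) :
    thetaThree t ^ 4 = thetaTwo t ^ 4 + thetaFour t ^ 4 := by
  linear_combination (thetaThree t ^ 2 + thetaThree (2 * t) ^ 2 + thetaTwo (2 * t) ^ 2) *
    thetaThree_sq ht - (thetaFour t ^ 2 + thetaThree (2 * t) ^ 2 - thetaTwo (2 * t) ^ 2) *
    thetaFour_sq ht - (thetaTwo t ^ 2 + 2 * thetaTwo (2 * t) * thetaThree (2 * t)) * thetaTwo_sq ht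

theorem thetaThree_mul_thetaFour (ht : 0 < t) :
    thetaThree t * thetaFour t = thetaFour (2 * t) ^ 2 := by
  have ht2 : 0 < 2 * t := by positivity
  have h3 := thetaThree_pos ht
  have h4 := thetaFour_pos ht
  have h42 := thetaFour_pos ht2
  refine (sq_eq_sq₀ (by positivity) (by positivity)).1 ?_
  linear_combination thetaFour t ^ 2 * thetaThree_sq ht +
    (thetaThree (2 * t) ^ 2 + thetaTwo (2 * t) ^ 2) * thetaFour_sq ht + thetaThree_pow_four ht2

/-- This gives an explicit series for `√(θ₂ θ₄)`, up to the sign of `thetaQuarter`. -/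
theorem two_mul_thetaQuarter_sq (ht : 0 < t) :
    2 * thetaQuarter t ^ 2 = thetaTwo t * thetaFour t := by
  have ht4 : 0 < 4 * t := by positivity
  have h := (hasSum_thetaQuarter ht).mul_prod (hasSum_thetaQuarter ht)
  have hA := hasSum_int_evenKernel (1 / 4) ht4
  have hB := hasSum_int_evenKernel (3 / 4) ht4
  have hAB : evenKernel ((3 / 4 : ℝ) : UnitAddCircle) (4 * t) =
      evenKernel ((1 / 4 : ℝ) : UnitAddCircle) (4 * t) := by
    rw [← evenKernel_neg, ← AddCircle.coe_neg, ← AddCircle.coe_add_period]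
    norm_num
  have h2 : thetaTwo t = 2 * evenKernel ((1 / 4 : ℝ) : UnitAddCircle) (4 * t) := by
    rw [thetaTwo, evenKernel_eq_add _ ht]
    norm_num [hAB]
    ring
  have hP : thetaQuarter t ^ 2 = evenKernel ((1 / 4 : ℝ) : UnitAddCircle) (4 * t) *
      thetaThree (4 * t) - evenKernel ((3 / 4 : ℝ) : UnitAddCircle) (4 * t) * thetaTwo (4 * t) := by
    rw [pow_two, ← h.tsum_eq, tsum_eq_add_of_rotation h.summable,
      ← (hA.mul_prod (hasSum_thetaThree ht4)).tsum_eq,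
      ← (hB.mul_prod (hasSum_thetaTwo ht4)).tsum_eq, sub_eq_add_neg, ← tsum_neg]
    simp only [neg_one_zpow_mul_exp_mul, ← exp_add]
    congr! 3 with p p
    · rw [show p.1 + p.2 + (p.1 - p.2) = 2 * p.1 by ring, neg_one_zpow_two_mul, one_mul]
      congr 1; push_cast; ring
    · rw [show p.1 + p.2 + 1 + (p.1 - p.2) = 2 * p.1 + 1 by ring, neg_one_zpow_two_mul_add_one,
        neg_one_mul]
      congr 2; push_cast; ring
  rw [hP, h2, thetaFour_eq_sub ht, hAB]
  ring

theorem continuousOn_thetaQuarter : ContinuousOn thetaQuarter (Set.Ioi 0) := by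
  have h8 : Set.MapsTo (fun t : ℝ => 8 * t) (Set.Ioi 0) (Set.Ioi 0) := fun t ht => by
    simpa using ht
  refine ContinuousOn.congr (f := fun t => evenKernel ((1 / 8 : ℝ) : UnitAddCircle) (8 * t) -
      evenKernel ((5 / 8 : ℝ) : UnitAddCircle) (8 * t)) ?_ fun t ht => thetaQuarter_eq_sub ht
  exact ((continuousOn_evenKernel _).comp (by fun_prop) h8).sub
    ((continuousOn_evenKernel _).comp (by fun_prop) h8)

/-- A continuous function without zeros on `(0, ∞)` has constant sign there. -/
theorem thetaQuarter_mul_pos {s : ℝ} (hs : 0 < s) (ht : 0 < t) :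
    0 < thetaQuarter s * thetaQuarter t := by
  have hne : ∀ u ∈ Set.Ioi (0 : ℝ), thetaQuarter u ≠ 0 := fun u hu h0 => by
    have h := two_mul_thetaQuarter_sq hu
    rw [h0] at h
    have := mul_pos (thetaTwo_pos hu) (thetaFour_pos hu)
    linarith
  by_contra! hle
  obtain ⟨u, hu, hu0⟩ : (0 : ℝ) ∈ thetaQuarter '' Set.Ioi 0 := by
    have hconn := isPreconnected_Ioi.image thetaQuarter continuousOn_thetaQuarter
    rcases mul_nonpos_iff.1 hle with h | h
    · exact hconn.ordConnected.out (Set.mem_image_of_mem _ ht) (Set.mem_image_of_mem _ hs) ⟨h.2, h.1⟩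
    · exact hconn.ordConnected.out (Set.mem_image_of_mem _ hs) (Set.mem_image_of_mem _ ht) h
  exact hne u hu hu0

end ThetaConstants

section ThetaIdentities

open Real HurwitzZeta Function
variable {t : ℝ}

/-! ### Theta identities of degrees 3 and 7 -/

/-- The pairs `(m, n)` with `m + n` even cancel, and those with `m + n` odd are written as
`(2k + 1 + n, n)`. -/
theorem thetaThree_mul_sub_thetaFour_mul (ht : 0 < t) {c : ℝ} (hc : 0 < c) :
    thetaThree t * thetaThree (c * t) - thetaFour t * thetaFour (c * t) =
      2 * ∑' p : ℤ × ℤ, exp (-π * t * ((2 * p.1 + 1 + p.2) ^ 2 + c * p.2 ^ 2)) := by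
  have hct : 0 < c * t := by positivity
  have h3 := (hasSum_thetaThree ht).mul_prod (hasSum_thetaThree hct)
  have h4 := (hasSum_thetaFour ht).mul_prod (hasSum_thetaFour hct)
  have e3 := tsum_eq_add_of_parity h3.summable
  have e4 := tsum_eq_add_of_parity h4.summable
  rw [h3.tsum_eq] at e3
  rw [h4.tsum_eq] at e4
  simp only [neg_one_zpow_mul_exp_mul,
    show ∀ p : ℤ × ℤ, 2 * p.1 + p.2 + p.2 = 2 * (p.1 + p.2) by intro; ring,
    show ∀ p : ℤ × ℤ, 2 * p.1 + 1 + p.2 + p.2 = 2 * (p.1 + p.2) + 1 by intro; ring,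
    neg_one_zpow_two_mul, neg_one_zpow_two_mul_add_one, one_mul, neg_one_mul, tsum_neg] at e4
  simp only [← exp_add] at e3
  have : ∑' p : ℤ × ℤ, exp (-π * t * ((2 * p.1 + 1 + p.2) ^ 2 + c * p.2 ^ 2)) =
      ∑' p : ℤ × ℤ, exp (-π * ((2 * p.1 + 1 + p.2 : ℤ) : ℝ) ^ 2 * t +
        -π * (p.2 : ℝ) ^ 2 * (c * t)) :=
    tsum_congr fun p => congrArg exp (by push_cast; ring)
  rw [e3, e4, this]
  ring

/-- The series of `θ₂(q) θ₂(q³)` runs over `(u² + 3v²)/4` with `u`, `v` odd. Exactly one of `u - v`,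
`u + v` is divisible by `4`, and in each case multiplying `(u + v√-3)/2` by a suitable sixth root of
unity gives, up to conjugation, some `m + n√-3` with `m + n` odd; every such `m + n√-3` arises once
in each case. -/
theorem theta_degree_three (ht : 0 < t) :
    thetaThree t * thetaThree (3 * t) =
      thetaTwo t * thetaTwo (3 * t) + thetaFour t * thetaFour (3 * t) := by
  have ht3 : 0 < 3 * t := by positivity
  have h2 := (hasSum_thetaTwo ht).mul_prod (hasSum_thetaTwo ht3)
  have hD := thetaThree_mul_sub_thetaFour_mul ht (c := 3) (by norm_num)
  suffices h : thetaTwo t * thetaTwo (3 * t) =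
      2 * ∑' p : ℤ × ℤ, exp (-π * t * ((2 * p.1 + 1 + p.2) ^ 2 + 3 * p.2 ^ 2)) by linarith
  rw [two_mul, ← h2.tsum_eq, tsum_eq_add_of_rotation h2.summable]
  congr 1
  · refine Eq.trans (tsum_congr fun p => ?_)
      (tsum_comp_eq_of_inverse (fun p => (p.1 - p.2, p.2)) (fun p => (p.1 + p.2, p.2))
      (fun p => Prod.ext (by ring) (by ring)) (fun p => Prod.ext (by ring) (by ring)))
    rw [← exp_add]
    congr 1; push_cast; ring
  · refine Eq.trans (tsum_congr fun p => ?_)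
      (tsum_comp_eq_of_inverse (fun p => (p.2 - p.1 - 1, p.1 + 1)) (fun p => (p.2 - 1, p.1 + p.2))
      (fun p => Prod.ext (by ring) (by ring)) (fun p => Prod.ext (by ring) (by ring)))
    rw [← exp_add]
    congr 1; push_cast; ring

/-- The values `m² + 7n²` with `m + n` odd, summed over the class `m + n ≡ 1 mod 4`; the class
`m + n ≡ 3 mod 4` is its image under `(m, n) ↦ (-m, -n)`. -/
theorem tsum_odd_norm_seven (ht : 0 < t) :
    ∑' p : ℤ × ℤ, exp (-π * t * ((2 * p.1 + 1 + p.2) ^ 2 + 7 * p.2 ^ 2)) =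
      2 * ∑' p : ℤ × ℤ, exp (-π * t * ((4 * p.1 + 1 - p.2) ^ 2 + 7 * p.2 ^ 2)) := by
  have hs : Summable fun p : ℤ × ℤ =>
      exp (-π * t * ((2 * p.1 + 1 + p.2) ^ 2 + 7 * p.2 ^ 2)) := by
    have h := ((hasSum_thetaThree ht).mul_prod
      (hasSum_thetaThree (t := 7 * t) (by positivity))).summable
    refine (h.comp_injective (i := fun p : ℤ × ℤ => (2 * p.1 + 1 + p.2, p.2)) ?_).congr fun p => ?_
    · rintro ⟨a, b⟩ ⟨c, d⟩ h
      simp only [Prod.mk.injEq] at h ⊢; omega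
    · simp only [comp_apply, ← exp_add]
      congr 1; push_cast; ring
  rw [two_mul, tsum_eq_add_of_injective_of_cover hs
    (e₀ := fun p : ℤ × ℤ => (2 * p.1 - p.2, p.2)) (e₁ := fun p : ℤ × ℤ => (2 * p.1 + 1 - p.2, p.2))]
  · congr 1
    · refine tsum_congr fun p => congrArg exp ?_
      push_cast; ring
    · rw [← tsum_comp_eq_of_inverse (fun p => (-p.1 - 1, -p.2)) (fun p => (-p.1 - 1, -p.2))
        (fun p => by ext <;> simp) (fun p => by ext <;> simp)]
      refine tsum_congr fun p => congrArg exp ?_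
      push_cast; ring
  · rintro ⟨a, b⟩ ⟨c, d⟩ h
    simp only [Prod.mk.injEq] at h ⊢; omega
  · rintro ⟨a, b⟩ ⟨c, d⟩ h
    simp only [Prod.mk.injEq] at h ⊢; omega
  · rintro ⟨a, b⟩ ⟨c, d⟩ h
    simp only [Prod.mk.injEq] at h; omega
  · rintro ⟨a, b⟩
    obtain ⟨k, hk | hk⟩ := (a + b).even_or_odd'
    · exact .inl ⟨(k, b), Prod.ext (by dsimp only; omega) rfl⟩
    · exact .inr ⟨(k, b), Prod.ext (by dsimp only; omega) rfl⟩

/-- The values `(u² + 7v²)/4` with `u`, `v` odd, summed over the class `u + v ≡ 2 mod 8`. The four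
even residues of `u + v` modulo `8` contribute equally: `v ↦ -v` exchanges the classes `0` and `2`
modulo `4`, and `(u, v) ↦ (-u, -v)` exchanges the classes `2` and `6` modulo `8`. -/
theorem thetaTwo_mul_thetaTwo_seven (ht : 0 < t) :
    thetaTwo t * thetaTwo (7 * t) =
      4 * ∑' p : ℤ × ℤ, exp (-π * t * ((8 * p.1 - 2 * p.2 + 1) ^ 2 + 7 * (2 * p.2 + 1) ^ 2) / 4) := by
  have h2 := (hasSum_thetaTwo ht).mul_prod (hasSum_thetaTwo (t := 7 * t) (by positivity))
  have inj₀ : Injective fun p : ℤ × ℤ => (2 * p.1 - p.2, p.2) := by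
    rintro ⟨a, b⟩ ⟨c, d⟩ h
    simp only [Prod.mk.injEq] at h ⊢; omega
  have inj₁ : Injective fun p : ℤ × ℤ => (2 * p.1 + 1 - p.2, p.2) := by
    rintro ⟨a, b⟩ ⟨c, d⟩ h
    simp only [Prod.mk.injEq] at h ⊢; omega
  have e₁ := tsum_eq_add_of_injective_of_cover h2.summable inj₀ inj₁
    (by
      rintro ⟨a, b⟩ ⟨c, d⟩ h
      simp only [Prod.mk.injEq] at h; omega)
    (by
      rintro ⟨a, b⟩
      obtain ⟨k, hk | hk⟩ := (a + b).even_or_odd'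
      · exact .inl ⟨(k, b), Prod.ext (by dsimp only; omega) rfl⟩
      · exact .inr ⟨(k, b), Prod.ext (by dsimp only; omega) rfl⟩)
  have e₂ : ∑' p : ℤ × ℤ, exp (-π * ((2 * p.1 + 1 - p.2 : ℤ) + 1 / 2) ^ 2 * t) *
        exp (-π * (p.2 + 1 / 2) ^ 2 * (7 * t)) =
      ∑' p : ℤ × ℤ, exp (-π * ((2 * p.1 - p.2 : ℤ) + 1 / 2) ^ 2 * t) *
        exp (-π * (p.2 + 1 / 2) ^ 2 * (7 * t)) := by
    refine Eq.trans (tsum_congr fun p => ?_)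
      (tsum_comp_eq_of_inverse (fun p => (p.1 - p.2, -p.2 - 1))
      (fun p => (p.1 - p.2 - 1, -p.2 - 1))
      (fun p => Prod.ext (by ring) (by ring)) (fun p => Prod.ext (by ring) (by ring)))
    simp only [← exp_add]
    congr 1; push_cast; ring
  have hs := h2.summable.comp_injective inj₀
  have e₃ := tsum_eq_add_of_injective_of_cover hs (e₀ := fun p : ℤ × ℤ => (2 * p.1, p.2))
    (e₁ := fun p : ℤ × ℤ => (2 * p.1 + 1, p.2))
    (by
      rintro ⟨a, b⟩ ⟨c, d⟩ h
      simp only [Prod.mk.injEq] at h ⊢; omega)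
    (by
      rintro ⟨a, b⟩ ⟨c, d⟩ h
      simp only [Prod.mk.injEq] at h ⊢; omega)
    (by
      rintro ⟨a, b⟩ ⟨c, d⟩ h
      simp only [Prod.mk.injEq] at h; omega)
    (by
      rintro ⟨a, b⟩
      obtain ⟨k, hk | hk⟩ := a.even_or_odd'
      · exact .inl ⟨(k, b), Prod.ext (by dsimp only; omega) rfl⟩
      · exact .inr ⟨(k, b), Prod.ext (by dsimp only; omega) rfl⟩)
  simp only [comp_apply] at e₃
  have e₄ : ∑' p : ℤ × ℤ, exp (-π * ((2 * (2 * p.1) - p.2 : ℤ) + 1 / 2) ^ 2 * t) *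
        exp (-π * (p.2 + 1 / 2) ^ 2 * (7 * t)) =
      ∑' p : ℤ × ℤ, exp (-π * t * ((8 * p.1 - 2 * p.2 + 1) ^ 2 + 7 * (2 * p.2 + 1) ^ 2) / 4) := by
    refine tsum_congr fun p => ?_
    rw [← exp_add]
    congr 1; push_cast; ring
  have e₅ : ∑' p : ℤ × ℤ, exp (-π * ((2 * (2 * p.1 + 1) - p.2 : ℤ) + 1 / 2) ^ 2 * t) *
        exp (-π * (p.2 + 1 / 2) ^ 2 * (7 * t)) =
      ∑' p : ℤ × ℤ, exp (-π * t * ((8 * p.1 - 2 * p.2 + 1) ^ 2 + 7 * (2 * p.2 + 1) ^ 2) / 4) := by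
    rw [← tsum_comp_eq_of_inverse (fun p => (-p.1 - 1, -p.2 - 1)) (fun p => (-p.1 - 1, -p.2 - 1))
      (fun p => by ext <;> simp) (fun p => by ext <;> simp)]
    refine tsum_congr fun p => ?_
    rw [← exp_add]
    congr 1; push_cast; ring
  rw [← h2.tsum_eq, e₁, e₂, e₃, e₄, e₅]
  ring

/-- With `u = 4a + 1`, `v = 4b + 1`, the exponent `(u² + 7v²)/8` is the norm of
`((u + v√-7)/2) / ((1 + √-7)/2) = (r + s√-7)/2`, where `r = a + 7b + 2` and `s = b - a`. The sign
`(-1)^(a + b)` is the parity of `s`, which separates the elements of `ℤ[√-7]` from the others. -/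
theorem thetaQuarter_mul_thetaQuarter_seven (ht : 0 < t) :
    thetaQuarter t * thetaQuarter (7 * t) =
      ∑' p : ℤ × ℤ, exp (-π * t * ((4 * p.1 + 1 - p.2) ^ 2 + 7 * p.2 ^ 2)) -
      ∑' p : ℤ × ℤ, exp (-π * t * ((8 * p.1 - 2 * p.2 + 1) ^ 2 + 7 * (2 * p.2 + 1) ^ 2) / 4) := by
  have h := (hasSum_thetaQuarter ht).mul_prod (hasSum_thetaQuarter (t := 7 * t) (by positivity))
  rw [← h.tsum_eq, tsum_eq_add_of_injective_of_cover h.summable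
    (e₀ := fun p : ℤ × ℤ => (p.1 - 2 * p.2, p.1)) (e₁ := fun p : ℤ × ℤ => (p.1 - 2 * p.2 - 1, p.1)),
    sub_eq_add_neg, ← tsum_neg]
  · simp only [neg_one_zpow_mul_exp_mul]
    congr! 3 with p p
    · rw [show p.1 - 2 * p.2 + p.1 = 2 * (p.1 - p.2) by ring, neg_one_zpow_two_mul, one_mul]
      congr 1; push_cast; ring
    · rw [show p.1 - 2 * p.2 - 1 + p.1 = 2 * (p.1 - p.2 - 1) + 1 by ring,
        neg_one_zpow_two_mul_add_one, neg_one_mul]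
      congr 2; push_cast; ring
  · rintro ⟨a, b⟩ ⟨c, d⟩ h
    simp only [Prod.mk.injEq] at h ⊢; omega
  · rintro ⟨a, b⟩ ⟨c, d⟩ h
    simp only [Prod.mk.injEq] at h ⊢; omega
  · rintro ⟨a, b⟩ ⟨c, d⟩ h
    simp only [Prod.mk.injEq] at h; omega
  · rintro ⟨a, b⟩
    obtain ⟨k, hk | hk⟩ := (b - a).even_or_odd'
    · exact .inl ⟨(b, k), Prod.ext (by dsimp only; omega) rfl⟩
    · exact .inr ⟨(b, k), Prod.ext (by dsimp only; omega) rfl⟩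

/-- Squaring, the claim is `θ₃θ₃ - θ₂θ₂ - θ₄θ₄ = 2 √(θ₂θ₂θ₄θ₄)` (the second factors at `7t`), where
the root on the right is `2 thetaQuarter t * thetaQuarter (7 * t)`. -/
theorem theta_degree_seven (ht : 0 < t) :
    √(thetaThree t * thetaThree (7 * t)) =
      √(thetaTwo t * thetaTwo (7 * t)) + √(thetaFour t * thetaFour (7 * t)) := by
  have ht7 : 0 < 7 * t := by positivity
  have hA := mul_pos (thetaThree_pos ht) (thetaThree_pos ht7)
  have hB := mul_pos (thetaFour_pos ht) (thetaFour_pos ht7)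
  have hC := mul_pos (thetaTwo_pos ht) (thetaTwo_pos ht7)
  have hlin : thetaThree t * thetaThree (7 * t) - thetaFour t * thetaFour (7 * t) -
      thetaTwo t * thetaTwo (7 * t) = 4 * (thetaQuarter t * thetaQuarter (7 * t)) := by
    rw [thetaThree_mul_sub_thetaFour_mul ht (by norm_num), tsum_odd_norm_seven ht,
      thetaTwo_mul_thetaTwo_seven ht, thetaQuarter_mul_thetaQuarter_seven ht]
    ring
  have hsq : √(thetaTwo t * thetaTwo (7 * t)) * √(thetaFour t * thetaFour (7 * t)) =
      2 * (thetaQuarter t * thetaQuarter (7 * t)) := by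
    have hP := thetaQuarter_mul_pos ht ht7
    rw [← sqrt_mul hC.le, sqrt_eq_iff_mul_self_eq (by positivity) (by positivity)]
    linear_combination -2 * thetaQuarter (7 * t) ^ 2 * two_mul_thetaQuarter_sq ht -
      thetaTwo t * thetaFour t * two_mul_thetaQuarter_sq ht7
  rw [sqrt_eq_iff_mul_self_eq hA.le (by positivity)]
  linear_combination hlin - sq_sqrt hC.le - sq_sqrt hB.le - 2 * hsq

end ThetaIdentities

open Real HurwitzZeta Filter Topology
variable {t : ℝ}

/-! ### Parametrisation of the moduli by theta constants -/

theorem tendsto_cosKernel_atTop (a : UnitAddCircle) : Tendsto (cosKernel a) atTop (𝓝 1) := by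
  obtain ⟨p, hp, h⟩ := isBigO_atTop_cosKernel_sub a
  have h0 : Tendsto (fun x : ℝ => exp (-p * x)) atTop (𝓝 0) :=
    tendsto_exp_atBot.comp (tendsto_id.const_mul_atTop_of_neg (by linarith))
  have := (h.trans_tendsto h0).add_const 1
  simpa using this

theorem tendsto_thetaThree_atTop : Tendsto thetaThree atTop (𝓝 1) := by
  have h : thetaThree = cosKernel 0 := by
    funext t
    rw [thetaThree, QuotientAddGroup.mk_zero, evenKernel_eq_cosKernel_of_zero]
  exact h ▸ tendsto_cosKernel_atTop 0

theorem tendsto_thetaFour_atTop : Tendsto thetaFour atTop (𝓝 1) :=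
  tendsto_cosKernel_atTop _

/-- By the duplication formulas, `t ↦ 2t` acts on `(θ₃², θ₄²)` as the arithmetic-geometric mean step,
so the integral keeps its value along `2ⁿ t`, where both arguments tend to `1`. -/
theorem ellipticI_theta (ht : 0 < t) : ellipticI (thetaThree t ^ 2) (thetaFour t ^ 2) = π / 2 := by
  have hpow : ∀ n : ℕ, 0 < 2 ^ n * t := fun n => by positivity
  have hstep : ∀ n : ℕ, ellipticI (thetaThree (2 ^ n * t) ^ 2) (thetaFour (2 ^ n * t) ^ 2) =
      ellipticI (thetaThree t ^ 2) (thetaFour t ^ 2) := by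
    intro n
    induction n with
    | zero => simp
    | succ n ih =>
      have h := hpow n
      have h3 := thetaThree_pos h
      have h4 := thetaFour_pos h
      rw [← ih, ← ellipticI_gauss (a := thetaThree (2 ^ n * t) ^ 2) (by positivity) (by positivity),
        ← mul_pow, sqrt_sq (by positivity), thetaThree_mul_thetaFour h, thetaThree_sq h,
        thetaFour_sq h, show (2 : ℝ) ^ (n + 1) * t = 2 * (2 ^ n * t) by ring]
      congr 1
      ring
  have hbd : ∀ n : ℕ, ellipticI (thetaThree t ^ 2) (thetaFour t ^ 2) ∈
      Set.Icc (π / 2 / thetaThree (2 ^ n * t) ^ 2) (π / 2 / thetaFour (2 ^ n * t) ^ 2) := by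
    intro n
    have h := hpow n
    have h4 := thetaFour_pos h
    rw [← hstep n]
    refine ellipticI_mem_Icc (by positivity) ?_
    rw [thetaThree_sq h, thetaFour_sq h]
    nlinarith [sq_nonneg (thetaTwo (2 * (2 ^ n * t)))]
  have htop : Tendsto (fun n : ℕ => 2 ^ n * t) atTop atTop :=
    (tendsto_pow_atTop_atTop_of_one_lt one_lt_two).atTop_mul_const ht
  have hlim : ∀ f : ℝ → ℝ, Tendsto f atTop (𝓝 1) →
      Tendsto (fun n : ℕ => π / 2 / f (2 ^ n * t) ^ 2) atTop (𝓝 (π / 2)) := fun f hf => by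
    have h := (tendsto_const_nhds (x := π / 2)).div ((hf.comp htop).pow 2) (by simp)
    rwa [one_pow, div_one] at h
  exact le_antisymm (ge_of_tendsto' (hlim _ tendsto_thetaFour_atTop) fun n => (hbd n).2)
    (le_of_tendsto' (hlim _ tendsto_thetaThree_atTop) fun n => (hbd n).1)

/-- The modulus `θ₂² / θ₃²` at the nome `q = exp (-π t)`. -/
noncomputable def thetaModulus (t : ℝ) : ℝ := thetaTwo t ^ 2 / thetaThree t ^ 2

theorem complModulus_thetaModulus (ht : 0 < t) :
    complModulus (thetaModulus t) = thetaFour t ^ 2 / thetaThree t ^ 2 := by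
  have h3 := thetaThree_pos ht
  have h4 := thetaFour_pos ht
  rw [complModulus, sqrt_eq_iff_mul_self_eq_of_pos (by positivity), thetaModulus]
  field_simp
  linear_combination -thetaThree_pow_four ht

theorem thetaModulus_mem_Ioo (ht : 0 < t) : thetaModulus t ∈ Set.Ioo (0 : ℝ) 1 := by
  have h2 := thetaTwo_pos ht
  have h3 := thetaThree_pos ht
  have h4 := thetaFour_pos ht
  have hpos : 0 < thetaModulus t := by unfold thetaModulus; positivity
  refine ⟨hpos, ?_⟩
  have h : 0 < complModulus (thetaModulus t) := by
    rw [complModulus_thetaModulus ht]; positivity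
  have := sqrt_pos.1 h
  nlinarith

theorem complModulus_thetaModulus_eq_inv (ht : 0 < t) :
    complModulus (thetaModulus t) = thetaModulus (1 / t) := by
  have h3 := thetaThree_pos ht
  have hs := sqrt_pos.2 ht
  rw [complModulus_thetaModulus ht, thetaModulus, thetaTwo_functional_equation,
    thetaThree_functional_equation]
  field_simp

theorem completeEllipticK_thetaModulus (ht : 0 < t) :
    completeEllipticK (thetaModulus t) = π / 2 * thetaThree t ^ 2 := by
  have h3 := thetaThree_pos ht
  have hmem := thetaModulus_mem_Ioo ht
  have h := ellipticI_theta ht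
  rw [completeEllipticK_eq (by nlinarith [hmem.1, hmem.2]), complModulus_thetaModulus ht]
  rw [show thetaThree t ^ 2 = thetaThree t ^ 2 * 1 by ring,
    show thetaFour t ^ 2 = thetaThree t ^ 2 * (thetaFour t ^ 2 / thetaThree t ^ 2) by field_simp,
    ellipticI_mul_mul (by positivity), div_eq_iff (by positivity)] at h
  exact h

/-- The parameter `t` is recovered from the modulus as `K' / K`. -/
theorem completeEllipticK_ratio_thetaModulus (ht : 0 < t) :
    completeEllipticK (complModulus (thetaModulus t)) / completeEllipticK (thetaModulus t) = t := by
  have h3 := thetaThree_pos ht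
  rw [complModulus_thetaModulus_eq_inv ht, completeEllipticK_thetaModulus (by positivity),
    completeEllipticK_thetaModulus ht, thetaThree_functional_equation, mul_pow, sq_sqrt ht.le]
  field_simp

theorem eq_thetaModulus {k : ℝ} (h0 : 0 < k) (h1 : k < 1) (ht : 0 < t)
    (h : completeEllipticK (complModulus k) / completeEllipticK k = t) : k = thetaModulus t :=
  eq_of_completeEllipticK_ratio_eq ⟨h0, h1⟩ (thetaModulus_mem_Ioo ht)
    (h.trans (completeEllipticK_ratio_thetaModulus ht).symm)

theorem MultiplicationLaw.exists_thetaModulus {n k l : ℝ} (hn : 0 < n) (hk0 : 0 < k) (hk1 : k < 1)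
    (hl0 : 0 < l) (hl1 : l < 1) (h : MultiplicationLaw n k l) :
    ∃ t, 0 < t ∧ l = thetaModulus t ∧ k = thetaModulus (n * t) := by
  have ht : 0 < completeEllipticK (complModulus l) / completeEllipticK l :=
    div_pos (completeEllipticK_pos (complModulus_pos hl0 hl1) (complModulus_lt_one hl0))
      (completeEllipticK_pos hl0 hl1)
  exact ⟨_, ht, eq_thetaModulus hl0 hl1 ht rfl, eq_thetaModulus hk0 hk1 (mul_pos hn ht) h.symm⟩

/-! ### Modular equations and singular moduli -/

theorem thetaModulus_mul (s t : ℝ) : thetaModulus s * thetaModulus t =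
    (thetaTwo t * thetaTwo s / (thetaThree t * thetaThree s)) ^ 2 := by
  unfold thetaModulus; ring

theorem complModulus_thetaModulus_mul {s : ℝ} (hs : 0 < s) (ht : 0 < t) :
    complModulus (thetaModulus s) * complModulus (thetaModulus t) =
      (thetaFour t * thetaFour s / (thetaThree t * thetaThree s)) ^ 2 := by
  rw [complModulus_thetaModulus hs, complModulus_thetaModulus ht]; ring

theorem modular_equation_three {k l : ℝ} (hk0 : 0 < k) (hk1 : k < 1) (hl0 : 0 < l) (hl1 : l < 1)
    (h : MultiplicationLaw 3 k l) : √(k * l) + √(complModulus k * complModulus l) = 1 := by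
  obtain ⟨t, ht, rfl, rfl⟩ := h.exists_thetaModulus (by norm_num) hk0 hk1 hl0 hl1
  have ht3 : 0 < 3 * t := by positivity
  have h2 := mul_pos (thetaTwo_pos ht) (thetaTwo_pos ht3)
  have h3 := mul_pos (thetaThree_pos ht) (thetaThree_pos ht3)
  have h4 := mul_pos (thetaFour_pos ht) (thetaFour_pos ht3)
  rw [thetaModulus_mul, complModulus_thetaModulus_mul ht3 ht, sqrt_sq (by positivity),
    sqrt_sq (by positivity), ← add_div, ← theta_degree_three ht, div_self h3.ne']

theorem modular_equation_seven {k l : ℝ} (hk0 : 0 < k) (hk1 : k < 1) (hl0 : 0 < l) (hl1 : l < 1)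
    (h : MultiplicationLaw 7 k l) :
    (k * l) ^ (1 / 4 : ℝ) + (complModulus k * complModulus l) ^ (1 / 4 : ℝ) = 1 := by
  obtain ⟨t, ht, rfl, rfl⟩ := h.exists_thetaModulus (by norm_num) hk0 hk1 hl0 hl1
  have ht7 : 0 < 7 * t := by positivity
  have h2 := mul_pos (thetaTwo_pos ht) (thetaTwo_pos ht7)
  have h3 := mul_pos (thetaThree_pos ht) (thetaThree_pos ht7)
  have h4 := mul_pos (thetaFour_pos ht) (thetaFour_pos ht7)
  have hroot : ∀ x : ℝ, 0 < x → (x ^ 2) ^ (1 / 4 : ℝ) = √x := fun x hx => by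
    rw [sqrt_eq_rpow, ← rpow_natCast, ← rpow_mul hx.le]
    norm_num
  rw [thetaModulus_mul, complModulus_thetaModulus_mul ht7 ht, hroot _ (by positivity),
    hroot _ (by positivity), sqrt_div h2.le, sqrt_div h4.le, ← add_div, ← theta_degree_seven ht,
    div_self (sqrt_pos.2 h3).ne']

/-- If `α = k²` is a singular modulus of degree `n`, then `k` and `k'` satisfy the multiplication law
of degree `n`. -/
theorem exists_modulus_of_ramanujanF_eq {n α : ℝ} (hn : 1 < n) (h0 : 0 < α) (h1 : α < 1)
    (h : ramanujanF (1 - α) = √n * ramanujanF α) :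
    ∃ k, 0 < k ∧ k < 1 ∧ k ^ 2 = α ∧ α < 1 / 2 ∧ MultiplicationLaw n k (complModulus k) := by
  have hk0 : 0 < √α := sqrt_pos.2 h0
  have hk1 : √α < 1 := (sqrt_lt' one_pos).2 (by simpa using h1)
  have hsq : √α ^ 2 = α := sq_sqrt h0.le
  have hc0 := complModulus_pos hk0 hk1
  have hc1 := complModulus_lt_one hk0
  have hcsq : complModulus √α ^ 2 = 1 - α := by
    rw [complModulus, hsq, sq_sqrt (by linarith)]
  have hK := completeEllipticK_pos hk0 hk1
  have hs : 1 < √n := lt_sqrt_of_sq_lt (by simpa using hn)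
  have hn2 : √n ^ 2 = n := sq_sqrt (by linarith)
  have hKK : completeEllipticK (complModulus √α) = √n * completeEllipticK √α := by
    rw [completeEllipticK_eq_ramanujanF hc0 hc1, completeEllipticK_eq_ramanujanF hk0 hk1, hcsq, hsq,
      h]
    ring
  refine ⟨√α, hk0, hk1, hsq, ?_, ?_⟩
  · have hlt : completeEllipticK √α < completeEllipticK (complModulus √α) := by
      rw [hKK]; nlinarith
    have := (completeEllipticK_strictMonoOn.lt_iff_lt ⟨hk0, hk1⟩ ⟨hc0, hc1⟩).1 hlt
    have := pow_lt_pow_left₀ this hk0.le two_ne_zero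
    linarith
  · rw [MultiplicationLaw, complModulus_complModulus hk0 hk1, hKK]
    have hs0 : 0 < √n := one_pos.trans hs
    field_simp
    exact hn2.symm

theorem eq_of_mul_one_sub_eq {α r : ℝ} (hα : α < 1 / 2) (hr : r ≤ 1 / 2)
    (h : α * (1 - α) = r * (1 - r)) : α = r := by
  have : (α - r) * (1 - α - r) = 0 := by linear_combination h
  rcases mul_eq_zero.1 this with h | h <;> linarith

theorem mainTheorem8 :
    -- the modular equation of degree 3
    (∀ k l : ℝ, 0 < k → k < 1 → 0 < l → l < 1 → MultiplicationLaw 3 k l →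
      Real.sqrt (k * l) + Real.sqrt (complModulus k * complModulus l) = 1) ∧
    -- the modular equation of degree 7
    (∀ k l : ℝ, 0 < k → k < 1 → 0 < l → l < 1 → MultiplicationLaw 7 k l →
      (k * l) ^ (1 / 4 : ℝ) + (complModulus k * complModulus l) ^ (1 / 4 : ℝ) = 1) ∧
    -- the values of the singular moduli of degrees 3 and 7
    (∀ α : ℝ, 0 < α → α < 1 →
      ramanujanF (1 - α) = Real.sqrt 3 * ramanujanF α → α = (2 - Real.sqrt 3) / 4) ∧
    (∀ α : ℝ, 0 < α → α < 1 →
      ramanujanF (1 - α) = Real.sqrt 7 * ramanujanF α → α = (8 - 3 * Real.sqrt 7) / 16) := by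
  refine ⟨fun k l hk0 hk1 hl0 hl1 h => modular_equation_three hk0 hk1 hl0 hl1 h,
    fun k l hk0 hk1 hl0 hl1 h => modular_equation_seven hk0 hk1 hl0 hl1 h, ?_, ?_⟩
  · intro α h0 h1 h
    obtain ⟨k, hk0, hk1, rfl, hlt, hM⟩ := exists_modulus_of_ramanujanF_eq (by norm_num) h0 h1 h
    have hc0 := complModulus_pos hk0 hk1
    have hE := modular_equation_three hk0 hk1 hc0 (complModulus_lt_one hk0) hM
    have hcsq : complModulus k ^ 2 = 1 - k ^ 2 := sq_sqrt (by linarith)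
    -- For `l = k'` the two terms of the modular equation coincide.
    rw [complModulus_complModulus hk0 hk1, mul_comm (complModulus k), ← two_mul] at hE
    have hroot : √(k * complModulus k) = 1 / 2 := by linarith
    have hprod : k * complModulus k = 1 / 4 := by
      rw [← sq_sqrt (mul_pos hk0 hc0).le, hroot]; norm_num
    have h3 : √3 ^ 2 = (3 : ℝ) := sq_sqrt (by norm_num)
    refine eq_of_mul_one_sub_eq hlt (by linarith [sqrt_nonneg 3]) ?_
    rw [← hcsq, ← mul_pow, hprod]
    linear_combination h3 / 16
  · intro α h0 h1 h
    obtain ⟨k, hk0, hk1, rfl, hlt, hM⟩ := exists_modulus_of_ramanujanF_eq (by norm_num) h0 h1 h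
    have hc0 := complModulus_pos hk0 hk1
    have hE := modular_equation_seven hk0 hk1 hc0 (complModulus_lt_one hk0) hM
    have hcsq : complModulus k ^ 2 = 1 - k ^ 2 := sq_sqrt (by linarith)
    -- For `l = k'` the two terms of the modular equation coincide.
    rw [complModulus_complModulus hk0 hk1, mul_comm (complModulus k), ← two_mul] at hE
    have hroot : (k * complModulus k) ^ (1 / 4 : ℝ) = 1 / 2 := by linarith
    have hprod : k * complModulus k = 1 / 16 := by
      have h4 : ((k * complModulus k) ^ (1 / 4 : ℝ)) ^ 4 = k * complModulus k := by
        rw [← rpow_natCast, ← rpow_mul (mul_pos hk0 hc0).le]; norm_num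
      rw [← h4, hroot]; norm_num
    have h7 : √7 ^ 2 = (7 : ℝ) := sq_sqrt (by norm_num)
    refine eq_of_mul_one_sub_eq hlt (by linarith [sqrt_nonneg 7]) ?_
    rw [← hcsq, ← mul_pow, hprod]
    linear_combination 9 * h7 / 256
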